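/- **Setting.** Graphs are directed multigraphs (self-loops and parallel edges allowed) in which every vertex has out-degree $\deg(u)\ge 1$, counted with multiplicity; $m$ denotes the number of edges. For a jumping probability $\epsilon\in(0,1)$, the PageRank vector $\pi$ of an $n$-vertex graph is the stationary distribution of the random walk which in each step jumps to a uniformly random vertex with probability $\epsilon$, and otherwise follows a uniformly random outgoing edge. A vector $P$ is an additive $\alpha$-approximation of PageRank if $\sum_v|P_v-\pi_v|\le\alpha$. The dynamic ForwardPush algorithm with error parameter $\gamma>0$ keeps estimates $P_v$ (initially $0$) and residuals $R_v$ (initially $1/n$). A *push* at $u$ replaces $R_u=r$ by $0$, adds $\epsilon r$ to $P_u$, and adds $(1-\epsilon)r/\deg(u)$ to $R_w$ for each outgoing edge $uw$ of $u$ (also when $w=u$); it takes $\deg(u)$ time. On the initial graph, and again after each edge insertion, the algorithm pushes at vertices $u$ with $|R_u|>\gamma\deg(u)$, in an arbitrary order, until there are none. When an edge $uv$ is inserted, and $d$ is the out-degree of $u$ before the insertion, it first (in one unit of time) multiplies $P_u$ by $(d+1)/d$ and then, with this new value $P_u$, decreases $R_u$ by $P_u/(\epsilon(d+1))$ and increases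 $R_v$ by $(1-\epsilon)P_u/(\epsilon(d+1))$. For a given initial graph and insertion sequence, the algorithm with parameter $\gamma$ *maintains an additive $\alpha$-approximation of PageRank* if in every execution (every order of pushes), the vector $P$ after the initial computation and after each insertion has been processed is an additive $\alpha$-approximation of the PageRank of the current graph. **Theorem.** There is an absolute constant $C>0$ such that for every $\delta>0$ there are $c>0$ and $n_0$ such that for all $n\ge n_0$, all $\epsilon\in(0.01,0.99)$ and all $\alpha\in(0,1)$ there are a graph on $n$ vertices with all out-degrees at least $1$ and a sequence of at most $Cn$ edge insertions, after which the graph has $m\le Cn$ edges, such that: 1. for every $\gamma>0$ with $\gamma m\le\alpha$, where $m$ is the final number of edges, ForwardPush with error parameter $\gamma$ maintains an additive $\alpha$-approximation of PageRank on this sequence; 2. for every error parameter $\gamma>0$ with which ForwardPush maintains an additive $\alpha$-approximation of PageRank on this sequence (in particular for every $\gamma\in(0,\alpha/m]$), every execution of ForwardPush spends at least $c\,n^{2-\delta}$ time on processing the insertions, not counting the initial computation. -/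

import Mathlib

noncomputable section

namespace ForwardPush

/-- A directed multigraph on the vertex set `V` (parallel edges and self-loops are allowed):
`G u v` is the number of edges from `u` to `v`. -/
abbrev MultiDigraph (V : Type) : Type := V → V → ℕ

/-- The out-degree of `u`, counted with multiplicity. -/
def outDeg {V : Type} [Fintype V] (G : MultiDigraph V) (u : V) : ℕ := ∑ v, G u v

/-- The number of edges, counted with multiplicity. -/
def numEdges {V : Type} [Fintype V] (G : MultiDigraph V) : ℕ := ∑ u, outDeg G u

/-- Insertion of one edge `e = (u, v)`, directed from `u` to `v`. -/
def addEdge {V : Type} [DecidableEq V] (G : MultiDigraph V) (e : V × V) : MultiDigraph V :=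
  fun x y => G x y + if x = e.1 ∧ y = e.2 then 1 else 0

/-- The graph obtained from `G` by inserting the edges of the list `es`, in this order. -/
def addEdges {V : Type} [DecidableEq V] (G : MultiDigraph V) (es : List (V × V)) :
    MultiDigraph V :=
  es.foldl addEdge G

/-- Transition matrix of the random walk which jumps to a uniformly random vertex with
probability `ε`, and otherwise follows a uniformly random outgoing edge. -/
def transition {V : Type} [Fintype V] (G : MultiDigraph V) (ε : ℝ) (i j : V) : ℝ :=
  ε / (Fintype.card V : ℝ) + (1 - ε) * ((G i j : ℝ) / (outDeg G i : ℝ))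

/-- `π` is the PageRank vector of `G` with jumping probability `ε`: the stationary distribution
of `transition G ε`. -/
structure IsPageRank {V : Type} [Fintype V] (G : MultiDigraph V) (ε : ℝ) (π : V → ℝ) :
    Prop where
  nonneg : ∀ v, 0 ≤ π v
  sum_eq_one : ∑ v, π v = 1
  stationary : ∀ j, ∑ i, π i * transition G ε i j = π j

/-- The data kept by the algorithm: PageRank estimates and residuals. -/
structure State (V : Type) where
  est : V → ℝ
  res : V → ℝ

/-- Before the first push, all estimates are `0` and all residuals are `1 / n`. -/
def initState (V : Type) [Fintype V] : State V where
  est := fun _ => 0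
  res := fun _ => 1 / (Fintype.card V : ℝ)

/-- Push at `u`: an `ε` fraction of the residual of `u` is added to the estimate of `u`, the
remaining `1 - ε` fraction is split evenly among the outgoing edges of `u`, and the old residual
of `u` is removed (what is sent along a self-loop of `u` arrives at `u` again). -/
def push {V : Type} [Fintype V] [DecidableEq V] (G : MultiDigraph V) (ε : ℝ) (s : State V)
    (u : V) : State V where
  est := fun w => s.est w + if w = u then ε * s.res u else 0
  res := fun w => (if w = u then 0 else s.res w) +
    (1 - ε) * s.res u * ((G u w : ℝ) / (outDeg G u : ℝ))

/-- The correction made when the edge `e = (u, v)` is inserted into `G`. With `d` the out-degree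
of `u` before the insertion and `P`, `R` the estimates and residuals,
`P u` is multiplied by `(d + 1) / d`, and then, with the new value of `P u`,
`R u` is decreased by `P u / (ε (d + 1))` and `R v` is increased by
`(1 - ε) P u / (ε (d + 1))`. -/
def insertUpdate {V : Type} [Fintype V] [DecidableEq V] (G : MultiDigraph V) (ε : ℝ)
    (s : State V) (e : V × V) : State V :=
  let d : ℝ := (outDeg G e.1 : ℝ)
  let p : ℝ := s.est e.1 * ((d + 1) / d)
  { est := fun w => if w = e.1 then p else s.est w
    res := fun w => s.res w - (if w = e.1 then p / (ε * (d + 1)) else 0) +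
      (if w = e.2 then (1 - ε) * p / (ε * (d + 1)) else 0) }

/-- No vertex is due for a push, for the error parameter `γ`. -/
def Settled {V : Type} [Fintype V] (G : MultiDigraph V) (γ : ℝ) (s : State V) : Prop :=
  ∀ u, |s.res u| ≤ γ * (outDeg G u : ℝ)

/-- `PushRun G ε γ s s' T`: some sequence of pushes, each at a vertex `u` with
`|R u| > γ deg u` at that moment, leads from `s` to `s'`. A push at `u` takes `deg u` time, and
`T` is the total time. The order in which violating vertices are served is arbitrary. -/
inductive PushRun {V : Type} [Fintype V] [DecidableEq V] (G : MultiDigraph V) (ε γ : ℝ) :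
    State V → State V → ℕ → Prop
  | nil (s : State V) : PushRun G ε γ s s 0
  | cons {s s' : State V} {T : ℕ} (u : V) (hu : γ * (outDeg G u : ℝ) < |s.res u|)
      (h : PushRun G ε γ (push G ε s u) s' T) : PushRun G ε γ s s' (outDeg G u + T)

/-- `UpdateRun ε γ G s es s' T`: the algorithm, in state `s` on the graph `G`, processes the
insertions `es` one after the other, ends in `s'`, and takes `T` time. Each insertion takes one
unit of time for the correction, followed by pushes until no vertex is due. -/
inductive UpdateRun {V : Type} [Fintype V] [DecidableEq V] (ε γ : ℝ) :
    MultiDigraph V → State V → List (V × V) → State V → ℕ → Prop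
  | nil (G : MultiDigraph V) (s : State V) : UpdateRun ε γ G s [] s 0
  | cons {G : MultiDigraph V} {s s₁ s₂ : State V} {e : V × V} {es : List (V × V)} {T₁ T₂ : ℕ}
      (hpush : PushRun (addEdge G e) ε γ (insertUpdate G ε s e) s₁ T₁)
      (hsettled : Settled (addEdge G e) γ s₁)
      (hrest : UpdateRun ε γ (addEdge G e) s₁ es s₂ T₂) :
      UpdateRun ε γ G s (e :: es) s₂ (1 + T₁ + T₂)

/-- `Execution ε γ G es s T`: some execution of dynamic ForwardPush with error parameter `γ`,
started on the graph `G` and then given the insertions `es`, ends in the state `s` and spends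
time `T` on the insertions. The time of the initial computation on `G` is not charged. -/
def Execution {V : Type} [Fintype V] [DecidableEq V] (ε γ : ℝ) (G : MultiDigraph V)
    (es : List (V × V)) (s : State V) (T : ℕ) : Prop :=
  ∃ (s₀ : State V) (T₀ : ℕ), PushRun G ε γ (initState V) s₀ T₀ ∧ Settled G γ s₀ ∧
    UpdateRun ε γ G s₀ es s T

/-- With error parameter `γ`, the algorithm maintains an additive `α`-approximation of PageRank:
in every execution, after the initial computation and after each insertion, the estimates are
within `ℓ₁`-distance `α` of the PageRank vector of the current graph. -/
def MaintainsApprox {V : Type} [Fintype V] [DecidableEq V] (ε γ α : ℝ) (G : MultiDigraph V)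
    (es : List (V × V)) : Prop :=
  ∀ pre : List (V × V), pre <+: es → ∀ (s : State V) (T : ℕ), Execution ε γ G pre s T →
    ∃ π : V → ℝ, IsPageRank (addEdges G pre) ε π ∧ ∑ v, |s.est v - π v| ≤ α

end ForwardPush

end

/-! Estimates and residuals satisfy a linear identity (`Inv.eqn`): up to a perturbation given by the
residuals, the estimates solve the PageRank equation. The walk does not increase the `ℓ₁` norm, so
settled estimates are within `γ m` of PageRank, which is claim 1. The identity also bounds
individual estimates from below in every settled state, whatever the order of pushes.

For claim 2, the insertions build a `b`-ary tree in preorder with geometric multiplicities. A node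
starts with one edge to the sink, so after the `2 ^ a` edges to its `a`-th child exactly half of its
edges lead there. While the subtree of that child is built, the child holds a constant fraction of
its parent's weight; thus each leaf is heavy at its turn, at a loss of at most `400` per level. The
edge from the leaf to the hub then changes the hub's residual so much that a push of cost `N` is
unavoidable (`PushRun.outDeg_hub_le`). This happens at all `b ^ h` leaves (`le_time_treeSeq`). The
root is heavy because at least a quarter of the vertices point to it and `γ < 1 / n` forces pushes
at them (`MaintainsApprox.lt_inv_card`).

Taking `b` logarithmic in `n` keeps `2 ^ b` and `400 ^ h` small powers of `n`, while `b ^ h` and `N`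
are both close to `n`. -/

namespace ForwardPush

/-! ### Degrees and multiplicities after insertions -/

section Graph

variable {V : Type} [DecidableEq V]

theorem addEdges_cons (G : MultiDigraph V) (e : V × V) (es : List (V × V)) :
    addEdges G (e :: es) = addEdges (addEdge G e) es := rfl

theorem addEdges_append (G : MultiDigraph V) (l₁ l₂ : List (V × V)) :
    addEdges G (l₁ ++ l₂) = addEdges (addEdges G l₁) l₂ :=
  List.foldl_append

theorem addEdges_apply (G : MultiDigraph V) (es : List (V × V)) (u w : V) :
    addEdges G es u w = G u w + es.count (u, w) := by
  induction es generalizing G with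
  | nil => rfl
  | cons e es ih =>
    rw [addEdges_cons, ih, List.count_cons, addEdge]
    have : (u = e.1 ∧ w = e.2) ↔ (e == (u, w)) = true := by
      rw [beq_iff_eq, Prod.ext_iff]; simp only [eq_comm]
    simp only [this]; ring

variable [Fintype V]

theorem outDeg_addEdge (G : MultiDigraph V) (e : V × V) (u : V) :
    outDeg (addEdge G e) u = outDeg G u + if u = e.1 then 1 else 0 := by
  by_cases h : u = e.1 <;> simp [outDeg, addEdge, Finset.sum_add_distrib, h]

theorem outDeg_addEdges (G : MultiDigraph V) (es : List (V × V)) (u : V) :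
    outDeg (addEdges G es) u = outDeg G u + es.countP (fun e => e.1 = u) := by
  induction es generalizing G with
  | nil => rfl
  | cons e es ih =>
    rw [addEdges_cons, ih, List.countP_cons, outDeg_addEdge]
    by_cases h : u = e.1
    · simp only [h, if_true, decide_true]; ring
    · simp [h, Ne.symm h]

theorem numEdges_addEdge (G : MultiDigraph V) (e : V × V) :
    numEdges (addEdge G e) = numEdges G + 1 := by
  simp [numEdges, outDeg_addEdge, Finset.sum_add_distrib]

theorem numEdges_addEdges (G : MultiDigraph V) (es : List (V × V)) :
    numEdges (addEdges G es) = numEdges G + es.length := by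
  induction es generalizing G with
  | nil => rfl
  | cons e es ih => rw [addEdges_cons, ih, numEdges_addEdge, List.length_cons]; ring

end Graph

/-! ### Existence and `ℓ₁`-stability of PageRank -/

section PageRank

variable {V : Type} [Fintype V]

theorem sum_div_outDeg {G : MultiDigraph V} {u : V} (hu : 1 ≤ outDeg G u) :
    ∑ w, (G u w : ℝ) / (outDeg G u : ℝ) = 1 := by
  rw [← Finset.sum_div, ← Nat.cast_sum]
  exact div_self (Nat.cast_ne_zero.2 (by rw [← outDeg]; omega))

theorem sum_walk {G : MultiDigraph V} (hG : ∀ u, 1 ≤ outDeg G u) (x : V → ℝ) :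
    ∑ w, ∑ u, x u * ((G u w : ℝ) / (outDeg G u : ℝ)) = ∑ u, x u := by
  rw [Finset.sum_comm]
  simp_rw [← Finset.mul_sum, sum_div_outDeg (hG _), mul_one]

theorem sum_abs_walk_le {G : MultiDigraph V} (hG : ∀ u, 1 ≤ outDeg G u) (x : V → ℝ) :
    ∑ w, |∑ u, x u * ((G u w : ℝ) / (outDeg G u : ℝ))| ≤ ∑ u, |x u| := by
  rw [← sum_walk hG fun u => |x u|]
  refine Finset.sum_le_sum fun w _ => (Finset.abs_sum_le_sum_abs _ _).trans_eq ?_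
  refine Finset.sum_congr rfl fun u _ => ?_
  rw [abs_mul, abs_of_nonneg (a := (G u w : ℝ) / _) (by positivity)]

/-- A solution of the perturbed walk equation is bounded in `ℓ₁` by the perturbation. -/
theorem sum_abs_le_of_walk_eq {G : MultiDigraph V} (hG : ∀ u, 1 ≤ outDeg G u) {ε : ℝ}
    (hε : 0 < ε) (hε1 : ε < 1) {x r : V → ℝ}
    (h : ∀ w, x w = (1 - ε) * ∑ u, x u * ((G u w : ℝ) / (outDeg G u : ℝ)) + ε * r w) :
    ∑ w, |x w| ≤ ∑ w, |r w| := by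
  have h1 : ∑ w, |x w| ≤ (1 - ε) * ∑ w, |x w| + ε * ∑ w, |r w| := by
    calc ∑ w, |x w| ≤ ∑ w, ((1 - ε) * |∑ u, x u * ((G u w : ℝ) / (outDeg G u : ℝ))|
          + ε * |r w|) := by
          refine Finset.sum_le_sum fun w _ => ?_
          rw [h w]
          refine (abs_add_le _ _).trans_eq ?_
          rw [abs_mul, abs_mul, abs_of_pos hε, abs_of_pos (sub_pos.2 hε1)]
      _ ≤ _ := by
          rw [Finset.sum_add_distrib, ← Finset.mul_sum, ← Finset.mul_sum]
          have := mul_le_mul_of_nonneg_left (sum_abs_walk_le hG x) (sub_pos.2 hε1).le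
          linarith
  nlinarith

/-- The `ℓ₁` bound with zero perturbation makes the linear operator injective, hence surjective in
finite dimension. -/
theorem exists_walk_eq {G : MultiDigraph V} (hG : ∀ u, 1 ≤ outDeg G u) {ε : ℝ}
    (hε : 0 < ε) (hε1 : ε < 1) (r : V → ℝ) :
    ∃ x : V → ℝ, ∀ w,
      x w = (1 - ε) * ∑ u, x u * ((G u w : ℝ) / (outDeg G u : ℝ)) + ε * r w := by
  let L : (V → ℝ) →ₗ[ℝ] (V → ℝ) :=
    { toFun := fun x w => x w - (1 - ε) * ∑ u, x u * ((G u w : ℝ) / (outDeg G u : ℝ))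
      map_add' := fun x y => by
        ext w; simp only [Pi.add_apply, add_mul, Finset.sum_add_distrib]; ring
      map_smul' := fun c x => by
        ext w
        simp only [Pi.smul_apply, smul_eq_mul, mul_assoc, ← Finset.mul_sum, RingHom.id_apply]
        ring }
  have hL : Function.Injective L := by
    refine (injective_iff_map_eq_zero L).2 fun x hx => ?_
    have h0 := sum_abs_le_of_walk_eq hG hε hε1 (x := x) (r := fun _ => (0 : ℝ)) fun w => by
      have : x w - (1 - ε) * ∑ u, x u * ((G u w : ℝ) / (outDeg G u : ℝ)) = 0 := congrFun hx w
      linarith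
    ext w
    have h1 := Finset.single_le_sum (f := fun w => |x w|) (fun i _ => abs_nonneg _)
      (Finset.mem_univ w)
    simp only [Pi.zero_apply, abs_zero, Finset.sum_const_zero] at h0 h1 ⊢
    exact abs_nonpos_iff.1 (h1.trans h0)
  obtain ⟨x, hx⟩ := LinearMap.injective_iff_surjective.1 hL fun w => ε * r w
  refine ⟨x, fun w => ?_⟩
  have : x w - (1 - ε) * ∑ u, x u * ((G u w : ℝ) / (outDeg G u : ℝ)) = ε * r w := congrFun hx w
  linarith

theorem exists_isPageRank [Nonempty V] {G : MultiDigraph V} (hG : ∀ u, 1 ≤ outDeg G u) {ε : ℝ}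
    (hε : 0 < ε) (hε1 : ε < 1) :
    ∃ π : V → ℝ, IsPageRank G ε π ∧ ∀ w, π w =
      (1 - ε) * ∑ u, π u * ((G u w : ℝ) / (outDeg G u : ℝ)) + ε * (1 / (Fintype.card V : ℝ)) := by
  obtain ⟨π, hπ⟩ := exists_walk_eq hG hε hε1 fun _ => 1 / (Fintype.card V : ℝ)
  have hc : (Fintype.card V : ℝ) ≠ 0 := Nat.cast_ne_zero.2 Fintype.card_ne_zero
  have hone : ∑ _w : V, 1 / (Fintype.card V : ℝ) = 1 := by simp [hc]
  have hsum : ∑ w, π w = 1 := by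
    have h1 : ∑ w, π w = (1 - ε) * ∑ w, π w + ε := by
      conv_lhs => rw [Finset.sum_congr rfl fun w _ => hπ w]
      rw [Finset.sum_add_distrib, ← Finset.mul_sum, ← Finset.mul_sum, sum_walk hG, hone, mul_one]
    nlinarith
  -- Total mass `1` together with `ℓ₁` norm at most `1` excludes negative entries.
  have habs : ∑ w, |π w| ≤ 1 := by
    refine (sum_abs_le_of_walk_eq hG hε hε1 hπ).trans_eq (Eq.trans ?_ hone)
    exact Finset.sum_congr rfl fun w _ => abs_of_nonneg (one_div_nonneg.2 (Nat.cast_nonneg _))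
  refine ⟨π, ⟨fun v => ?_, hsum, fun j => ?_⟩, hπ⟩
  · have h0 : ∑ w, (|π w| - π w) ≤ 0 := by rw [Finset.sum_sub_distrib]; linarith
    have h1 := Finset.single_le_sum (f := fun w => |π w| - π w)
      (fun i _ => sub_nonneg.2 (le_abs_self _)) (Finset.mem_univ v)
    have := abs_nonneg (π v)
    linarith
  · have : ∀ i, π i * transition G ε i j = ε / (Fintype.card V : ℝ) * π i +
        (1 - ε) * (π i * ((G i j : ℝ) / (outDeg G i : ℝ))) := fun i => by
      rw [transition]; ring
    rw [Finset.sum_congr rfl fun i _ => this i, Finset.sum_add_distrib, ← Finset.mul_sum,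
      ← Finset.mul_sum, hsum]
    conv_rhs => rw [hπ j]
    ring

end PageRank

/-! ### The invariant and the accuracy of settled states -/

section Invariant

variable {V : Type} [Fintype V] [DecidableEq V]

/-- The invariant of ForwardPush: residuals are determined by the estimates, and a vertex of the
set `A`, whose members have no incoming edges, either has been pushed or keeps its initial
residual. -/
structure Inv (G : MultiDigraph V) (ε : ℝ) (A : Set V) (s : State V) : Prop where
  pos : ∀ u, 1 ≤ outDeg G u
  no_in : ∀ v ∈ A, ∀ u, G u v = 0
  source : ∀ v ∈ A, s.res v = 0 ∨ s.res v = 1 / (Fintype.card V : ℝ)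
  eqn : ∀ w, ε * s.res w = ε * (1 / (Fintype.card V : ℝ)) +
    (1 - ε) * ∑ u, s.est u * ((G u w : ℝ) / (outDeg G u : ℝ)) - s.est w

omit [DecidableEq V] in
theorem inv_initState {G : MultiDigraph V} (ε : ℝ) {A : Set V} (hG : ∀ u, 1 ≤ outDeg G u)
    (hA : ∀ v ∈ A, ∀ u, G u v = 0) : Inv G ε A (initState V) where
  pos := hG
  no_in := hA
  source _ _ := Or.inr rfl
  eqn w := by simp [initState]

theorem Inv.push {G : MultiDigraph V} {ε : ℝ} {A : Set V} {s : State V} (h : Inv G ε A s)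
    (u : V) : Inv G ε A (push G ε s u) where
  pos := h.pos
  no_in := h.no_in
  source v hv := by
    simp only [ForwardPush.push, h.no_in v hv, Nat.cast_zero, zero_div, mul_zero, add_zero]
    split_ifs
    · exact Or.inl rfl
    · exact h.source v hv
  eqn w := by
    have := h.eqn w
    simp only [ForwardPush.push, add_mul, Finset.sum_add_distrib, ite_mul, zero_mul,
      Finset.sum_ite_eq', Finset.mem_univ, if_true]
    by_cases hw : w = u
    · subst hw; simp only [if_true]; linear_combination this
    · simp only [hw, if_false]; linear_combination this

/-- Scaling `P u` by `(d + 1) / d` keeps the flow along each old edge of `u` unchanged. Only the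
growth of `P u` and the flow along the new edge remain, and the residual corrections absorb both. -/
theorem Inv.insertUpdate {G : MultiDigraph V} {ε : ℝ} {A : Set V} {s : State V}
    (h : Inv G ε A s) (hε : 0 < ε) {e : V × V} (he1 : e.1 ∉ A) (he2 : e.2 ∉ A) :
    Inv (addEdge G e) ε A (insertUpdate G ε s e) := by
  obtain ⟨u, v⟩ := e
  have hd : (0 : ℝ) < outDeg G u := Nat.cast_pos.2 (h.pos u)
  refine ⟨fun x => ?_, fun x hx y => ?_, fun x hx => ?_, fun w => ?_⟩
  · rw [outDeg_addEdge]; exact (h.pos x).trans (Nat.le_add_right _ _)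
  · have : x ≠ v := fun hxv => he2 (hxv ▸ hx)
    simp [addEdge, h.no_in x hx, this]
  · have h1 : x ≠ u := fun hxv => he1 (hxv ▸ hx)
    have h2 : x ≠ v := fun hxv => he2 (hxv ▸ hx)
    simpa [ForwardPush.insertUpdate, h1, h2] using h.source x hx
  · set p : ℝ := s.est u * ((outDeg G u + 1) / outDeg G u) with hp
    have hterm : ∀ x, (ForwardPush.insertUpdate G ε s (u, v)).est x *
        ((addEdge G (u, v) x w : ℝ) / (outDeg (addEdge G (u, v)) x : ℝ)) =
        s.est x * ((G x w : ℝ) / (outDeg G x : ℝ)) +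
          if x = u then (if w = v then p / (outDeg G u + 1) else 0) else 0 := by
      intro x
      rw [outDeg_addEdge]
      by_cases hx : x = u
      · subst hx
        by_cases hw : w = v
        · simp [ForwardPush.insertUpdate, addEdge, hw, hp]; field_simp
        · simp [ForwardPush.insertUpdate, addEdge, hw]; field_simp
      · simp [ForwardPush.insertUpdate, addEdge, hx]
    rw [Finset.sum_congr rfl fun x _ => hterm x, Finset.sum_add_distrib]
    simp only [Finset.sum_ite_eq', Finset.mem_univ, if_true, ForwardPush.insertUpdate]
    have hpu : p - s.est u = p / (outDeg G u + 1) := by rw [hp]; field_simp; ring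
    have hε' : ∀ y : ℝ, ε * (y / (ε * (outDeg G u + 1))) = y / (outDeg G u + 1) := fun y => by
      field_simp
    rw [← hp, mul_add, mul_sub, mul_ite, mul_ite, hε', hε', mul_zero]
    clear_value p
    have := h.eqn w
    by_cases hwu : w = u
    · subst hwu
      by_cases hwv : w = v
      · simp only [if_true, if_pos hwv]; linear_combination this + hpu
      · simp only [if_true, if_neg hwv]; linear_combination this + hpu
    · by_cases hwv : w = v
      · simp only [if_neg hwu, if_pos hwv]; linear_combination this
      · simp only [if_neg hwu, if_neg hwv]; linear_combination this

theorem Inv.pushRun {G : MultiDigraph V} {ε γ : ℝ} {A : Set V} {s s' : State V} {T : ℕ}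
    (h : Inv G ε A s) (hr : PushRun G ε γ s s' T) : Inv G ε A s' := by
  induction hr with
  | nil => exact h
  | cons u _ _ ih => exact ih (h.push u)

theorem Inv.updateRun {G : MultiDigraph V} {ε γ : ℝ} {A : Set V} {s s' : State V} {T : ℕ}
    {es : List (V × V)} (h : Inv G ε A s) (hε : 0 < ε) (hr : UpdateRun ε γ G s es s' T)
    (hes : ∀ e ∈ es, e.1 ∉ A ∧ e.2 ∉ A) : Inv (addEdges G es) ε A s' := by
  induction hr with
  | nil => exact h
  | cons hpush _ _ ih =>
    have he := hes _ List.mem_cons_self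
    exact ih ((h.insertUpdate hε he.1 he.2).pushRun hpush)
      fun e' he' => hes e' (List.mem_cons_of_mem _ he')

theorem UpdateRun.settled {G : MultiDigraph V} {ε γ : ℝ} {s s' : State V} {T : ℕ}
    {es : List (V × V)} (hr : UpdateRun ε γ G s es s' T) (hs : Settled G γ s) :
    Settled (addEdges G es) γ s' := by
  induction hr with
  | nil => exact hs
  | cons _ h1 _ ih => exact ih h1

theorem UpdateRun.exists_of_append {ε γ : ℝ} {s' : State V} {l₂ : List (V × V)}
    (l₁ : List (V × V)) {G : MultiDigraph V} {s : State V} {T : ℕ}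
    (hr : UpdateRun ε γ G s (l₁ ++ l₂) s' T) :
    ∃ s₁ T₁ T₂, UpdateRun ε γ G s l₁ s₁ T₁ ∧ UpdateRun ε γ (addEdges G l₁) s₁ l₂ s' T₂ ∧
      T = T₁ + T₂ := by
  induction l₁ generalizing G s T with
  | nil => exact ⟨s, 0, T, .nil _ _, hr, (zero_add _).symm⟩
  | cons e l₁ ih =>
    cases hr with
    | cons hpush hset hrest =>
      obtain ⟨s₁, T₁, T₂, h1, h2, rfl⟩ := ih hrest
      exact ⟨s₁, _, T₂, .cons hpush hset h1, h2, by ring⟩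

omit [DecidableEq V] in
-- The difference of the estimates and PageRank solves the walk equation with perturbation `-s.res`.
theorem Inv.exists_isPageRank [Nonempty V] {G : MultiDigraph V} {ε γ : ℝ} {A : Set V}
    {s : State V} (h : Inv G ε A s) (hε : 0 < ε) (hε1 : ε < 1) (hs : Settled G γ s) :
    ∃ π : V → ℝ, IsPageRank G ε π ∧ ∑ v, |s.est v - π v| ≤ γ * (numEdges G : ℝ) := by
  obtain ⟨π, hπ, heq⟩ := ForwardPush.exists_isPageRank h.pos hε hε1
  refine ⟨π, hπ, ?_⟩
  calc ∑ v, |s.est v - π v| ≤ ∑ v, |-s.res v| := by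
        refine sum_abs_le_of_walk_eq h.pos hε hε1 fun w => ?_
        simp only [sub_mul, Finset.sum_sub_distrib]
        linear_combination -heq w + h.eqn w
    _ ≤ ∑ v, γ * (outDeg G v : ℝ) := Finset.sum_le_sum fun v _ => by rw [abs_neg]; exact hs v
    _ = γ * (numEdges G : ℝ) := by rw [← Finset.mul_sum, numEdges, Nat.cast_sum]

theorem maintainsApprox_of_mul_numEdges_le [Nonempty V] {G : MultiDigraph V} {ε γ α : ℝ}
    {es : List (V × V)} (hG : ∀ u, 1 ≤ outDeg G u) (hε : 0 < ε) (hε1 : ε < 1) (hγ : 0 < γ)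
    (hm : γ * (numEdges (addEdges G es) : ℝ) ≤ α) : MaintainsApprox ε γ α G es := by
  rintro pre ⟨suf, rfl⟩ s T ⟨s₀, T₀, hpush, hset, hrun⟩
  have hinv := ((inv_initState (A := ∅) ε hG (by simp)).pushRun hpush).updateRun hε hrun (by simp)
  obtain ⟨π, hπ, hle⟩ := hinv.exists_isPageRank hε hε1 (hrun.settled hset)
  refine ⟨π, hπ, hle.trans (le_trans ?_ hm)⟩
  rw [addEdges_append, numEdges_addEdges _ suf, Nat.cast_add]
  have : (0 : ℝ) ≤ suf.length := Nat.cast_nonneg _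
  nlinarith

/-- Otherwise the initial state is already settled, and its zero estimates are at distance `1 > α`
from PageRank. -/
theorem MaintainsApprox.lt_inv_card {G : MultiDigraph V} {ε γ α : ℝ} {es : List (V × V)}
    (h : MaintainsApprox ε γ α G es) (hG : ∀ u, 1 ≤ outDeg G u) (hγ : 0 < γ) (hα : α < 1) :
    γ < 1 / (Fintype.card V : ℝ) := by
  by_contra! hle
  have hset : Settled G γ (initState V) := fun u => by
    have h1 : (1 : ℝ) ≤ outDeg G u := Nat.one_le_cast.2 (hG u)
    rw [initState, abs_of_nonneg (by positivity)]
    exact hle.trans (le_mul_of_one_le_right hγ.le h1)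
  obtain ⟨π, hπ, hd⟩ := h [] List.nil_prefix _ _ ⟨_, _, .nil _, hset, .nil _ _⟩
  simp only [initState, zero_sub, abs_neg] at hd
  rw [Finset.sum_congr rfl fun v _ => abs_of_nonneg (hπ.nonneg v), hπ.sum_eq_one] at hd
  linarith

end Invariant

end ForwardPush

namespace ForwardPush

/-! ### The insertion sequence -/

section Tree

variable {V : Type}

/-- Number of vertices of the `b`-ary tree of height `r`. -/
def treeSize (b : ℕ) : ℕ → ℕ
  | 0 => 1
  | r + 1 => 1 + b * treeSize b r

/-- The insertions in the subtree of height `r` whose root has the preorder number `x`: for each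
`a < b`, there are `2 ^ a` edges from the root to its `a`-th child, followed by the insertions in
the subtree of that child. At a leaf, an edge to `hub` is inserted. -/
def treeSeq (f : ℕ → V) (hub : V) (b : ℕ) : ℕ → ℕ → List (V × V)
  | 0, x => [(f x, hub)]
  | r + 1, x => (List.range b).flatMap fun a =>
      List.replicate (2 ^ a) (f x, f (x + 1 + a * treeSize b r)) ++
        treeSeq f hub b r (x + 1 + a * treeSize b r)

/-- The part of `treeSeq f hub b (r + 1) x` that belongs to the first `k` children. -/
def childSeq (f : ℕ → V) (hub : V) (b r x k : ℕ) : List (V × V) :=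
  (List.range k).flatMap fun a =>
    List.replicate (2 ^ a) (f x, f (x + 1 + a * treeSize b r)) ++
      treeSeq f hub b r (x + 1 + a * treeSize b r)

variable (f : ℕ → V) (hub : V) (b : ℕ)

theorem treeSeq_succ (r x : ℕ) : treeSeq f hub b (r + 1) x = childSeq f hub b r x b := rfl

theorem childSeq_succ (r x k : ℕ) : childSeq f hub b r x (k + 1) =
    childSeq f hub b r x k ++ (List.replicate (2 ^ k) (f x, f (x + 1 + k * treeSize b r)) ++
      treeSeq f hub b r (x + 1 + k * treeSize b r)) := by
  simp [childSeq, List.range_succ]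

theorem childSeq_prefix (r x : ℕ) {k l : ℕ} (h : k ≤ l) :
    childSeq f hub b r x k <+: childSeq f hub b r x l := by
  induction l, h using Nat.le_induction with
  | base => exact List.prefix_refl _
  | succ l _ ih =>
    rw [childSeq_succ]
    exact ih.trans (List.prefix_append _ _)

theorem treeSize_pos (r : ℕ) : 1 ≤ treeSize b r := by
  cases r <;> simp [treeSize]

theorem treeSize_le (r : ℕ) : treeSize b r ≤ (b + 1) ^ r := by
  induction r with
  | zero => simp [treeSize]
  | succ r ih =>
    have h1 : b * treeSize b r ≤ b * (b + 1) ^ r := Nat.mul_le_mul_left _ ih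
    have h2 : 1 ≤ (b + 1) ^ r := Nat.one_le_pow _ _ (Nat.succ_pos _)
    rw [treeSize, pow_succ]
    linarith

theorem length_treeSeq_le (r x : ℕ) : (treeSeq f hub b r x).length ≤ 2 ^ b * treeSize b r := by
  induction r generalizing x with
  | zero => simpa [treeSeq, treeSize] using Nat.one_le_two_pow
  | succ r ih =>
    -- The `+ 1` completes the geometric sum `2 ^ 0 + ⋯ + 2 ^ (k - 1)` to `2 ^ k`.
    have key : ∀ k, (childSeq f hub b r x k).length + 1 ≤
        2 ^ k + k * (2 ^ b * treeSize b r) := by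
      intro k
      induction k with
      | zero => simp [childSeq]
      | succ k ihk =>
        have := ih (x + 1 + k * treeSize b r)
        rw [childSeq_succ, List.length_append, List.length_append, List.length_replicate, pow_succ]
        linarith
    have := key b
    rw [treeSeq_succ, treeSize, mul_add, mul_one]
    linarith

theorem mem_childSeq {r : ℕ}
    (hr : ∀ x, ∀ e ∈ treeSeq f hub b r x, ∃ i, x ≤ i ∧ i < x + treeSize b r ∧ e.1 = f i ∧
      (e.2 = hub ∨ ∃ j, x < j ∧ j < x + treeSize b r ∧ e.2 = f j))
    {x k : ℕ} {e : V × V} (he : e ∈ childSeq f hub b r x k) :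
    ∃ i, x ≤ i ∧ i < x + 1 + k * treeSize b r ∧ e.1 = f i ∧
      (e.2 = hub ∨ ∃ j, x < j ∧ j < x + 1 + k * treeSize b r ∧ e.2 = f j) := by
  simp only [childSeq, List.mem_flatMap, List.mem_range, List.mem_append, List.mem_replicate] at he
  obtain ⟨a, ha, he⟩ := he
  have h1 : (a + 1) * treeSize b r ≤ k * treeSize b r := Nat.mul_le_mul_right _ ha
  have h2 := treeSize_pos b r
  rw [add_mul, one_mul] at h1
  rcases he with ⟨-, rfl⟩ | he
  · exact ⟨x, le_rfl, by omega, rfl, Or.inr ⟨_, by omega, by omega, rfl⟩⟩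
  · obtain ⟨i, hi1, hi2, hi3, hi4⟩ := hr _ e he
    refine ⟨i, by omega, by omega, hi3, hi4.imp_right ?_⟩
    rintro ⟨j, hj1, hj2, hj3⟩
    exact ⟨j, by omega, by omega, hj3⟩

theorem mem_treeSeq (r : ℕ) : ∀ x, ∀ e ∈ treeSeq f hub b r x, ∃ i, x ≤ i ∧
    i < x + treeSize b r ∧ e.1 = f i ∧
      (e.2 = hub ∨ ∃ j, x < j ∧ j < x + treeSize b r ∧ e.2 = f j) := by
  induction r with
  | zero =>
    intro x e he
    simp only [treeSeq, List.mem_singleton] at he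
    subst he
    exact ⟨x, le_rfl, by simp [treeSize], rfl, Or.inl rfl⟩
  | succ r ih =>
    intro x e he
    rw [treeSize, ← add_assoc]
    exact mem_childSeq f hub b ih (treeSeq_succ f hub b r x ▸ he)

variable [DecidableEq V] {f} {M : ℕ} (hf : ∀ i < M, ∀ j < M, f i = f j → i = j)
include hf

theorem countP_treeSeq_eq_zero {r c x : ℕ} (hc : c + treeSize b r ≤ M) (hx : x < M)
    (hxc : x < c ∨ c + treeSize b r ≤ x) {pre : List (V × V)}
    (hpre : pre <+: treeSeq f hub b r c) : pre.countP (fun e => e.1 = f x) = 0 := by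
  rw [List.countP_eq_zero]
  intro e he
  obtain ⟨i, hi1, hi2, hi3, -⟩ := mem_treeSeq f hub b r c e (hpre.subset he)
  rw [decide_eq_true_eq, hi3]
  intro h
  have := hf i (by omega) x hx h
  omega

/-- A geometric sum, since edges inside the children's subtrees start elsewhere. The `+ 1` stands
for the initial edge of the node to the sink. -/
theorem countP_childSeq {r x k : ℕ} (hx : x + 1 + k * treeSize b r ≤ M) :
    (childSeq f hub b r x k).countP (fun e => e.1 = f x) + 1 = 2 ^ k := by
  induction k with
  | zero => simp [childSeq]
  | succ k ih =>
    rw [add_mul, one_mul] at hx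
    rw [childSeq_succ, List.countP_append, List.countP_append, List.countP_replicate,
      countP_treeSeq_eq_zero hub b hf (by omega) (by omega) (Or.inl (by omega))
        (List.prefix_refl _), pow_succ, ← ih (by omega)]
    simp only [decide_true, if_true]
    ring

theorem countP_treeSeq_le (hb : 1 ≤ b) {r x : ℕ} (hx : x + treeSize b r ≤ M)
    {pre : List (V × V)} (hpre : pre <+: treeSeq f hub b r x) :
    1 + pre.countP (fun e => e.1 = f x) ≤ 2 ^ b := by
  have h1 := hpre.sublist.countP_le (p := fun e => decide (e.1 = f x))
  cases r with
  | zero =>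
    have : 2 ^ 1 ≤ 2 ^ b := Nat.pow_le_pow_right two_pos hb
    simp only [treeSeq, List.countP_singleton, decide_true, if_true] at h1
    omega
  | succ r =>
    rw [treeSize, ← add_assoc] at hx
    have := countP_childSeq hub b hf hx
    rw [treeSeq_succ] at h1
    omega

end Tree

/-! ### Forced pushes at the hub -/

section LowerBound

variable {V : Type} [Fintype V] [DecidableEq V]

/-- If `u` has residual `ρ` and one of its two edges leads to `hub`, and all vertices other than
`u`, `hub` and the sink `z` are settled, then a large residual of `hub` forces a push at `hub`. -/
theorem PushRun.outDeg_hub_le {G : MultiDigraph V} {ε γ ρ κ : ℝ} {u hub z : V} {s s' : State V}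
    {T : ℕ} (hr : PushRun G ε γ s s' T) (hs' : Settled G γ s') (huhub : u ≠ hub) (huz : u ≠ z)
    (hhubz : hub ≠ z) (hGu : ∀ w, w ≠ z → w ≠ hub → G u w = 0) (hGhub : G u hub = 1)
    (hdeg : outDeg G u = 2) (hGz : ∀ w, w ≠ z → G z w = 0)
    (hκ : γ * (outDeg G hub : ℝ) < κ) (hκρ : γ * (outDeg G hub : ℝ) < κ + (1 - ε) * ρ / 2)
    (hset : ∀ w, w ≠ u → w ≠ hub → w ≠ z → |s.res w| ≤ γ * (outDeg G w : ℝ))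
    (hst : (s.res u = ρ ∧ s.res hub = κ) ∨
      (s.res u = 0 ∧ s.res hub = κ + (1 - ε) * ρ / 2)) : outDeg G hub ≤ T := by
  induction hr with
  | nil s =>
    exfalso
    have h1 := (le_abs_self _).trans (hs' hub)
    rcases hst with ⟨-, h⟩ | ⟨-, h⟩ <;> rw [h] at h1 <;> linarith
  -- Before the first push at `hub`, only `u` and `z` can be due. Pushes at `z` change nothing
  -- elsewhere; a first push at `u` sends half of `(1 - ε) ρ` to `hub`, later ones send `0`.
  | @cons s s' T v hv hrun ih =>
    by_cases hvh : v = hub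
    · subst hvh; exact Nat.le_add_right _ _
    refine (ih hs' ?_ ?_).trans (Nat.le_add_left _ _)
    · intro w hwu hwh hwz
      have hGv : G v w = 0 := by
        by_cases hvu : v = u
        · exact hvu ▸ hGu w hwz hwh
        by_cases hvz : v = z
        · exact hvz ▸ hGz w hwz
        exact absurd (hset v hvu hvh hvz) (not_le.2 hv)
      have hwv : w ≠ v := by
        rintro rfl
        exact absurd (hset w hwu hwh hwz) (not_le.2 hv)
      simpa [push, hGv, hwv] using hset w hwu hwh hwz
    · by_cases hvu : v = u
      · subst hvu
        right
        refine ⟨by simp [push, hGu v huz huhub], ?_⟩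
        simp only [push, Ne.symm huhub, if_false, hGhub, hdeg]
        rcases hst with ⟨h1, h2⟩ | ⟨h1, h2⟩ <;> rw [h1, h2] <;> push_cast <;> ring
      · have hvz : v = z := by
          by_contra hvz
          exact absurd (hset v hvu hvh hvz) (not_le.2 hv)
        subst hvz
        simpa [push, hGz u huz, hGz hub hhubz, huz, hhubz] using hst

/-- The vertices `f i`, `i < M`, carry a tree, `hub` has out-degree `N`, all edges of the sink `z`
are loops, and the members of `A` have no incoming edges. -/
structure Setup (f : ℕ → V) (hub z : V) (A : Set V) (b N M : ℕ) (ε γ B : ℝ) : Prop where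
  inj : ∀ i < M, ∀ j < M, f i = f j → i = j
  f_ne_hub : ∀ i < M, f i ≠ hub
  f_ne_z : ∀ i < M, f i ≠ z
  f_not_mem : ∀ i < M, f i ∉ A
  hub_ne_z : hub ≠ z
  hub_not_mem : hub ∉ A
  one_le_b : 1 ≤ b
  lt_ε : 1 / 100 < ε
  ε_lt : ε < 99 / 100
  γ_pos : 0 < γ
  mul_two_pow_le : 400 * (γ * 2 ^ b) ≤ B
  mul_hub_lt : γ * (2 * N + 1) < B / 200

variable {f : ℕ → V} {hub z : V} {A : Set V} {b N M : ℕ} {ε γ B : ℝ}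

omit [Fintype V] [DecidableEq V] in
theorem Setup.not_mem_of_mem_treeSeq (S : Setup f hub z A b N M ε γ B) {r x : ℕ}
    (hx : x + treeSize b r ≤ M) {e : V × V} (he : e ∈ treeSeq f hub b r x) :
    e.1 ∉ A ∧ e.2 ∉ A := by
  obtain ⟨i, hi1, hi2, hi3, h | ⟨j, hj1, hj2, hj3⟩⟩ := mem_treeSeq f hub b r x e he
  · rw [hi3, h]; exact ⟨S.f_not_mem i (by omega), S.hub_not_mem⟩
  · rw [hi3, hj3]; exact ⟨S.f_not_mem i (by omega), S.f_not_mem j (by omega)⟩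

theorem outDeg_of_row {G : MultiDigraph V} {u z : V} (h : ∀ w, G u w = if w = z then 1 else 0) :
    outDeg G u = 1 := by
  simp [outDeg, h]

/-- The correction raises the hub's residual by `(1 - ε) P / ε` and lowers the leaf's by `P / ε`. A
push at the leaf, now of degree `2`, cancels only half of the raise. -/
theorem le_time_treeSeq_zero (S : Setup f hub z A b N M ε γ B) {x : ℕ} (hx : x < M)
    {G : MultiDigraph V} (hrow : ∀ w, G (f x) w = if w = z then 1 else 0)
    (hhub : outDeg G hub = N) (hz : ∀ w, w ≠ z → G z w = 0) {s s' : State V} {T : ℕ}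
    (hB : B ≤ s.est (f x)) (hs : Settled G γ s)
    (hr : UpdateRun ε γ G s (treeSeq f hub b 0 x) s' T) : N ≤ T := by
  have hε := S.lt_ε
  have hε1 := S.ε_lt
  have hxh := S.f_ne_hub x hx
  have hxz := S.f_ne_z x hx
  have hdeg : outDeg G (f x) = 1 := outDeg_of_row hrow
  simp only [treeSeq] at hr
  cases hr with
  | @cons _ _ s₁ _ _ _ T₁ T₂ hpush hset hrest =>
    have hN : outDeg (addEdge G (f x, hub)) hub = N := by
      rw [outDeg_addEdge, hhub, if_neg (Ne.symm hxh), add_zero]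
    have hP : 0 < s.est (f x) := by
      have := S.mul_two_pow_le
      have : 0 < γ * 2 ^ b := mul_pos S.γ_pos (by positivity)
      linarith
    set P := s.est (f x) with hPdef
    have hRu := abs_le.1 (hs (f x))
    have hRh := abs_le.1 (hs hub)
    rw [hdeg, Nat.cast_one, mul_one] at hRu
    rw [hhub] at hRh
    have hq : 1 / 100 * P ≤ (1 - ε) * P / ε := by
      rw [le_div_iff₀ (by linarith)]
      nlinarith
    -- In `2 * N + 1`, one `N` is the hub's threshold, the other its possibly negative old residual;
    -- the `1` covers the leaf's old residual.
    have hmul := S.mul_hub_lt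
    have hγ := S.γ_pos
    have hγN : 0 ≤ γ * N := by positivity
    have hRu' : -γ ≤ (1 - ε) * s.res (f x) := by nlinarith
    have key := hpush.outDeg_hub_le (ρ := s.res (f x) - P / ε)
      (κ := s.res hub + (1 - ε) * P / ε) (u := f x) (hub := hub) (z := z) hset hxh hxz S.hub_ne_z
      (fun w hwz hwh => by simp [addEdge, hrow, hwz, hwh])
      (by simp [addEdge, hrow, S.hub_ne_z])
      (by simp [outDeg_addEdge, hdeg])
      (fun w hw => by simp [addEdge, hz w hw, Ne.symm hxz])
      (by rw [hN]; nlinarith)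
      (by
        have : (1 - ε) * (s.res (f x) - P / ε) / 2 =
          (1 - ε) * s.res (f x) / 2 - (1 - ε) * P / ε / 2 := by ring
        rw [hN, this]; nlinarith)
      (fun w hwu hwh _ => by
        simpa [insertUpdate, hwu, hwh, outDeg_addEdge] using hs w)
      (Or.inl ⟨by
        simp only [insertUpdate, hdeg, if_true, hxh, if_false, ← hPdef]
        push_cast; field_simp; ring, by
        simp only [insertUpdate, hdeg, if_true, Ne.symm hxh, if_false, ← hPdef]
        push_cast; field_simp; ring⟩)
    rw [hN] at key
    omega

/-- Induction on the height. The weight of the root is assumed for every prefix and every settled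
state satisfying the invariant, not just for the given run, so that it passes to the children
independently of the order of pushes. -/
theorem le_time_treeSeq (S : Setup f hub z A b N M ε γ B) (r : ℕ) :
    ∀ (x : ℕ) (p : ℝ) (G : MultiDigraph V) (s s' : State V) (T : ℕ), x + treeSize b r ≤ M →
      (∀ i, x ≤ i → i < x + treeSize b r → ∀ w, G (f i) w = if w = z then 1 else 0) →
      (∀ i, x < i → i < x + treeSize b r → ∀ u, G u (f i) = 0) →
      outDeg G hub = N → (∀ w, w ≠ z → G z w = 0) →
      (∀ pre, pre <+: treeSeq f hub b r x → ∀ s, Inv (addEdges G pre) ε A s →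
        Settled (addEdges G pre) γ s → p ≤ s.est (f x)) →
      400 ^ r * B ≤ p → Inv G ε A s → Settled G γ s →
      UpdateRun ε γ G s (treeSeq f hub b r x) s' T → b ^ r * N ≤ T := by
  have hε := S.lt_ε
  have hε1 := S.ε_lt
  have hγ := S.γ_pos
  induction r with
  | zero =>
    intro x p G s s' T hx hrow _ hhub hz hheavy hp hinv hs hr
    rw [pow_zero, one_mul]
    rw [pow_zero, one_mul] at hp
    rw [treeSize] at hx hrow
    exact le_time_treeSeq_zero S (by omega) (hrow x le_rfl (by omega)) hhub hz
      (hp.trans (hheavy [] List.nil_prefix s hinv hs)) hs hr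
  | succ r ih =>
    intro x p G s s' T hx hrow hcol hhub hz hheavy hp hinv hs hr
    have hsz := treeSize_pos b r
    have key : ∀ k ≤ b, ∀ s' T, UpdateRun ε γ G s (childSeq f hub b r x k) s' T →
        k * (b ^ r * N) ≤ T := by
      intro k
      induction k with
      | zero => intro _ _ _ _; rw [zero_mul]; exact Nat.zero_le _
      | succ k ihk =>
        intro hk s' T hr
        set c := x + 1 + k * treeSize b r with hc
        have hkb : (k + 1) * treeSize b r ≤ b * treeSize b r := Nat.mul_le_mul_right _ hk
        rw [treeSize] at hx hrow hcol
        rw [add_mul, one_mul] at hkb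
        rw [childSeq_succ, ← hc] at hr
        obtain ⟨s₁, T₁, T₂, h1, h2, rfl⟩ := hr.exists_of_append
        obtain ⟨s₂, T₃, T₄, h3, h4, rfl⟩ := h2.exists_of_append
        have hT₁ := ihk (by omega) _ _ h1
        set l := childSeq f hub b r x k ++ List.replicate (2 ^ k) (f x, f c) with hl
        have hlpre : ∀ pre, pre <+: treeSeq f hub b r c →
            l ++ pre <+: treeSeq f hub b (r + 1) x := fun pre hpre => by
          refine List.IsPrefix.trans ?_ (childSeq_prefix f hub b r x hk)
          rw [childSeq_succ, ← hc, hl, List.append_assoc]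
          exact (List.prefix_append_right_inj _).2 ((List.prefix_append_right_inj _).2 hpre)
        have hGl : addEdges (addEdges G (childSeq f hub b r x k))
            (List.replicate (2 ^ k) (f x, f c)) = addEdges G l := (addEdges_append _ _ _).symm
        rw [hGl] at h4
        have hlmem : ∀ e ∈ l, ∃ i, x ≤ i ∧ i < c ∧ e.1 = f i ∧
            (e.2 = hub ∨ ∃ j, x < j ∧ j ≤ c ∧ e.2 = f j) := by
          intro e he
          rcases List.mem_append.1 he with he | he
          · obtain ⟨i, hi1, hi2, hi3, hi4⟩ := mem_childSeq f hub b (mem_treeSeq f hub b r) he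
            refine ⟨i, hi1, hi2, hi3, hi4.imp_right ?_⟩
            rintro ⟨j, hj1, hj2, hj3⟩
            exact ⟨j, hj1, hj2.le, hj3⟩
          · obtain ⟨-, rfl⟩ := List.mem_replicate.1 he
            exact ⟨x, le_rfl, by omega, rfl, Or.inr ⟨c, by omega, le_rfl, rfl⟩⟩
        have hcount : ∀ u w, (∀ i, x ≤ i → i < c → u ≠ f i) → l.count (u, w) = 0 := by
          intro u w hu
          rw [List.count_eq_zero]
          intro hmem
          obtain ⟨i, hi1, hi2, hi3, -⟩ := hlmem _ hmem
          exact hu i hi1 hi2 hi3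
        have hcountc : ∀ u, l.count (u, f c) = if u = f x then 2 ^ k else 0 := by
          intro u
          rw [hl, List.count_append, List.count_replicate, List.count_eq_zero.2, zero_add]
          · by_cases h : u = f x
            · simp [h]
            · simp [h, Ne.symm h]
          · intro hmem
            obtain ⟨i, hi1, hi2, hi3, h | ⟨j, hj1, hj2, hj3⟩⟩ :=
              mem_childSeq f hub b (mem_treeSeq f hub b r) hmem
            · exact S.f_ne_hub c (by omega) h
            · have := S.inj c (by omega) j (by omega) hj3
              omega
        -- The child receives `(1 - ε) / 2 ≥ 1 / 200` of the parent's weight, and its residual costs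
        -- at most `γ * 2 ^ b ≤ B / 400 ≤ p / 400`.
        have hT₄ := ih c (p / 400) (addEdges G l) s₂ s' T₄ (by omega)
          (fun i hi1 hi2 w => by
            rw [addEdges_apply, hcount, add_zero, hrow i (by omega) (by omega)]
            intro j hj1 hj2 h
            have := S.inj i (by omega) j (by omega) h
            omega)
          (fun i hi1 hi2 u => by
            rw [addEdges_apply, hcol i (by omega) (by omega), List.count_eq_zero.2]
            intro hmem
            obtain ⟨i', -, -, -, h | ⟨j, hj1, hj2, hj3⟩⟩ := hlmem _ hmem
            · exact S.f_ne_hub i (by omega) h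
            · have := S.inj i (by omega) j (by omega) hj3
              omega)
          (by
            rw [outDeg_addEdges, hhub, List.countP_eq_zero.2, add_zero]
            intro e he
            obtain ⟨i, hi1, hi2, hi3, -⟩ := hlmem e he
            rw [decide_eq_true_eq, hi3]
            exact S.f_ne_hub i (by omega))
          (fun w hw => by
            rw [addEdges_apply, hz w hw, hcount]
            intro i hi1 hi2 h
            exact S.f_ne_z i (by omega) h.symm)
          (fun pre hpre t htinv htset => by
            rw [← addEdges_append] at htinv htset
            have hPx := hheavy _ (hlpre pre hpre) t htinv htset
            -- The edge to the sink, `2 ^ k - 1` edges to earlier children and `2 ^ k` to the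
            -- current one.
            have hdegx : outDeg (addEdges G (l ++ pre)) (f x) = 2 ^ (k + 1) := by
              rw [outDeg_addEdges, outDeg_of_row (hrow x le_rfl (by omega)), List.countP_append,
                countP_treeSeq_eq_zero hub b S.inj (by omega) (by omega) (Or.inl (by omega)) hpre,
                hl, List.countP_append, List.countP_replicate]
              have := countP_childSeq hub b S.inj (r := r) (x := x) (k := k) (by omega)
              simp only [decide_true, if_true]
              rw [pow_succ]
              omega
            have hdegc : (outDeg (addEdges G (l ++ pre)) (f c) : ℝ) ≤ 2 ^ b := by
              have h0 : l.countP (fun e => e.1 = f c) = 0 := by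
                rw [List.countP_eq_zero]
                intro e he
                obtain ⟨i, hi1, hi2, hi3, -⟩ := hlmem e he
                rw [decide_eq_true_eq, hi3]
                intro h
                have := S.inj i (by omega) c (by omega) h
                omega
              have := countP_treeSeq_le hub b S.inj S.one_le_b (by omega) hpre
              rw [outDeg_addEdges, outDeg_of_row (hrow c (by omega) (by omega)),
                List.countP_append, h0, zero_add]
              exact_mod_cast this
            have hcolc : ∀ u, addEdges G (l ++ pre) u (f c) = if u = f x then 2 ^ k else 0 := by
              intro u
              rw [addEdges_apply, hcol c (by omega) (by omega), List.count_append, hcountc,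
                List.count_eq_zero (l := pre).2, zero_add, add_zero]
              intro hmem
              obtain ⟨i', -, -, -, h | ⟨j, hj1, hj2, hj3⟩⟩ :=
                mem_treeSeq f hub b r c _ (hpre.subset hmem)
              · exact S.f_ne_hub c (by omega) h
              · have := S.inj c (by omega) j (by omega) hj3
                omega
            have heq := htinv.eqn (f c)
            have hsum : ∑ u, t.est u * ((addEdges G (l ++ pre) u (f c) : ℝ) /
                (outDeg (addEdges G (l ++ pre)) u : ℝ)) = t.est (f x) / 2 := by
              rw [Finset.sum_eq_single (f x)]
              · rw [hcolc, if_pos rfl, hdegx, pow_succ]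
                push_cast
                field_simp
              · intro u _ hu
                rw [hcolc, if_neg hu, Nat.cast_zero, zero_div, mul_zero]
              · exact fun h => absurd (Finset.mem_univ _) h
            rw [hsum] at heq
            have hres := (abs_le.1 (htset (f c))).2
            have hres' : t.res (f c) ≤ γ * 2 ^ b :=
              hres.trans (mul_le_mul_of_nonneg_left hdegc hγ.le)
            have hcard : (0 : ℝ) ≤ 1 / (Fintype.card V : ℝ) := by positivity
            have hBp : B ≤ p := by
              have hB0 : 0 ≤ B := le_trans (by positivity) S.mul_two_pow_le
              exact le_trans (le_mul_of_one_le_left hB0 (one_le_pow₀ (by norm_num))) hp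
            have hB1 := S.mul_two_pow_le
            have hγb : 0 < γ * 2 ^ b := by positivity
            have e1 : ε * t.res (f c) ≤ γ * 2 ^ b := by nlinarith
            have e2 : 1 / 100 * p ≤ (1 - ε) * t.est (f x) := by nlinarith
            have e3 : 0 ≤ ε * (1 / (Fintype.card V : ℝ)) := by positivity
            nlinarith)
          (by rw [pow_succ] at hp; linarith)
          (by
            rw [← hGl]
            refine (hinv.updateRun (by linarith) h1 ?_).updateRun (by linarith) h3 ?_
            · intro e he
              exact S.not_mem_of_mem_treeSeq (r := r + 1) (x := x) (by rw [treeSize]; omega)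
                ((childSeq_prefix f hub b r x (by omega : k ≤ b)).subset he)
            · intro e he
              refine S.not_mem_of_mem_treeSeq (r := r + 1) (x := x) (by rw [treeSize]; omega)
                ((hlpre [] List.nil_prefix).subset ?_)
              rw [List.append_nil, hl]
              exact List.mem_append_right _ he)
          (by rw [← hGl]; exact h3.settled (h1.settled hs))
          h4
        rw [add_mul, one_mul]
        omega
    rw [pow_succ, mul_comm (b ^ r) b, mul_assoc]
    exact key b le_rfl s' T (treeSeq_succ f hub b r x ▸ hr)

end LowerBound

end ForwardPush

namespace ForwardPush

/-! ### The initial graph and the hard instance -/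

section BaseGraph

variable {V : Type} [DecidableEq V]

/-- `N` parallel edges from `hub` to `z`, an edge to `root` from every member of `A`, and an edge
to `z` from every other vertex. -/
def baseGraph (N : ℕ) (A : Finset V) (hub z root : V) : MultiDigraph V := fun u v =>
  if u = hub then (if v = z then N else 0)
  else if u ∈ A then (if v = root then 1 else 0) else if v = z then 1 else 0

variable [Fintype V]

theorem outDeg_baseGraph (N : ℕ) (A : Finset V) (hub z root u : V) :
    outDeg (baseGraph N A hub z root) u = if u = hub then N else 1 := by
  by_cases h : u = hub <;> by_cases h' : u ∈ A <;> simp [outDeg, baseGraph, h, h']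

theorem numEdges_baseGraph_le (N : ℕ) (A : Finset V) (hub z root : V) :
    numEdges (baseGraph N A hub z root) ≤ N + Fintype.card V := by
  have : ∀ u ∈ (Finset.univ : Finset V), outDeg (baseGraph N A hub z root) u ≤
      (if u = hub then N else 0) + 1 := fun u _ => by
    rw [outDeg_baseGraph]; split_ifs <;> omega
  refine (Finset.sum_le_sum this).trans_eq ?_
  simp [Finset.sum_add_distrib]

theorem le_time_of_execution {f : ℕ → V} {hub z : V} {A : Finset V} {b N M h : ℕ} {ε γ B : ℝ}
    (S : Setup f hub z A b N M ε γ B) (hN : 1 ≤ N) (hM : treeSize b h ≤ M) (hzA : z ∉ A)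
    (hA : Fintype.card V ≤ 4 * A.card) (hγ : γ < 1 / (Fintype.card V : ℝ))
    (hB : 400 ^ h * B ≤ 1 / 1000) {s : State V} {T : ℕ}
    (hex : Execution ε γ (baseGraph N A hub z (f 0)) (treeSeq f hub b h 0) s T) :
    b ^ h * N ≤ T := by
  obtain ⟨s₀, T₀, hpush, hset, hrun⟩ := hex
  set G := baseGraph N A hub z (f 0) with hG
  have hsz := treeSize_pos b h
  have hε := S.lt_ε
  have hε1 := S.ε_lt
  have hγ0 := S.γ_pos
  have hfA : ∀ i < M, f i ∉ A := fun i hi h' => S.f_not_mem i hi (Finset.mem_coe.2 h')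
  have hhubA : hub ∉ A := fun h' => S.hub_not_mem (Finset.mem_coe.2 h')
  have hrowA : ∀ u ∈ A, ∀ w, G u w = if w = f 0 then 1 else 0 := by
    intro u hu w
    have : u ≠ hub := fun h' => hhubA (h' ▸ hu)
    simp [hG, baseGraph, this, hu]
  have hrow : ∀ u, u ≠ hub → u ∉ A → ∀ w, G u w = if w = z then 1 else 0 := by
    intro u hu hu' w
    simp [hG, baseGraph, hu, hu']
  have hrowhub : ∀ w, w ≠ z → G hub w = 0 := by
    intro w hw
    simp [hG, baseGraph, hw]
  have hcol : ∀ w, w ≠ z → w ≠ f 0 → ∀ u, G u w = 0 := by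
    intro w hwz hw0 u
    by_cases hu : u = hub
    · rw [hu]; exact hrowhub w hwz
    by_cases hu' : u ∈ A
    · rw [hrowA u hu', if_neg hw0]
    · rw [hrow u hu hu', if_neg hwz]
  have hinv : Inv G ε A s₀ := by
    refine (inv_initState ε (fun u => ?_) fun v hv => ?_).pushRun hpush
    · rw [hG, outDeg_baseGraph]; split_ifs <;> omega
    · have hv' := Finset.mem_coe.1 hv
      exact hcol v (fun h' => hzA (h' ▸ hv')) (fun h' => hfA 0 (by omega) (h' ▸ hv'))
  refine le_time_treeSeq S h 0 (1 / 1000) G s₀ s T (by omega) ?_ ?_ ?_ ?_ ?_ hB hinv hset hrun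
  · intro i _ hi
    exact hrow _ (S.f_ne_hub i (by omega)) (hfA i (by omega))
  · intro i hi0 hi
    refine hcol _ (S.f_ne_z i (by omega)) fun h' => ?_
    have := S.inj i (by omega) 0 (by omega) h'
    omega
  · rw [hG, outDeg_baseGraph, if_pos rfl]
  · intro w hw
    rw [hrow z (Ne.symm S.hub_ne_z) hzA, if_neg hw]
  · intro pre hpre t htinv htset
    have hmem : ∀ e ∈ pre, ∃ i, i < M ∧ e.1 = f i ∧ e.2 ≠ f 0 := by
      intro e he
      obtain ⟨i, -, hi2, hi3, hi4⟩ := mem_treeSeq f hub b h 0 e (hpre.subset he)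
      refine ⟨i, by omega, hi3, ?_⟩
      rcases hi4 with h' | ⟨j, hj1, hj2, hj3⟩
      · rw [h']; exact Ne.symm (S.f_ne_hub 0 (by omega))
      · rw [hj3]
        intro h'
        have := S.inj j (by omega) 0 (by omega) h'
        omega
    have hcol0 : ∀ u, addEdges G pre u (f 0) = if u ∈ A then 1 else 0 := by
      intro u
      rw [addEdges_apply, List.count_eq_zero.2, add_zero]
      · by_cases hu : u ∈ A
        · rw [hrowA u hu, if_pos rfl, if_pos hu]
        · rw [if_neg hu]
          by_cases hu' : u = hub
          · rw [hu', hrowhub _ (S.f_ne_z 0 (by omega))]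
          · rw [hrow u hu' hu, if_neg (S.f_ne_z 0 (by omega))]
      · intro h'
        obtain ⟨-, -, -, h2⟩ := hmem _ h'
        exact h2 rfl
    have hdegA : ∀ u ∈ A, outDeg (addEdges G pre) u = 1 := by
      intro u hu
      have hne : u ≠ hub := fun h' => hhubA (h' ▸ hu)
      rw [outDeg_addEdges, hG, outDeg_baseGraph, if_neg hne, List.countP_eq_zero.2]
      intro e he
      obtain ⟨i, hi, h1, -⟩ := hmem e he
      rw [decide_eq_true_eq, h1]
      exact fun h' => hfA i hi (h' ▸ hu)
    -- As `γ` may be close to `1 / n`, the bound `|res| ≤ γ` alone would be too weak here; the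
    -- dichotomy `source` makes the residual exactly `0`.
    have hest : ∀ u ∈ A, t.est u = ε * (1 / (Fintype.card V : ℝ)) := by
      intro u hu
      have h1 := htinv.eqn u
      have h2 : t.res u = 0 := by
        refine (htinv.source u hu).resolve_right fun h' => ?_
        have h3 := (abs_le.1 (htset u)).2
        rw [hdegA u hu, h', Nat.cast_one, mul_one] at h3
        linarith
      have h4 := htinv.no_in u hu
      simp only [h4, h2, Nat.cast_zero, zero_div, mul_zero, Finset.sum_const_zero] at h1
      linarith
    have heq := htinv.eqn (f 0)
    have hsum : ∑ u, t.est u * ((addEdges G pre u (f 0) : ℝ) /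
        (outDeg (addEdges G pre) u : ℝ)) = A.card * (ε * (1 / (Fintype.card V : ℝ))) := by
      rw [← nsmul_eq_mul, ← Finset.sum_const, ← Finset.sum_subset (Finset.subset_univ A)]
      · refine Finset.sum_congr rfl fun u hu => ?_
        rw [hcol0, if_pos hu, hdegA u hu, hest u hu]
        simp
      · intro u _ hu
        rw [hcol0, if_neg hu, Nat.cast_zero, zero_div, mul_zero]
    rw [hsum] at heq
    have hdeg0 : (outDeg (addEdges G pre) (f 0) : ℝ) ≤ 2 ^ b := by
      have := countP_treeSeq_le hub b S.inj S.one_le_b (by omega) hpre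
      rw [outDeg_addEdges, hG, outDeg_baseGraph, if_neg (S.f_ne_hub 0 (by omega))]
      exact_mod_cast this
    have hres : t.res (f 0) ≤ γ * 2 ^ b :=
      (abs_le.1 (htset (f 0))).2.trans (mul_le_mul_of_nonneg_left hdeg0 hγ0.le)
    have hB1 := S.mul_two_pow_le
    have hγb : 0 < γ * 2 ^ b := by positivity
    have hB2 : B ≤ 1 / 1000 :=
      (le_mul_of_one_le_left (by linarith) (one_le_pow₀ (by norm_num))).trans hB
    have hcard : (0 : ℝ) < Fintype.card V := by
      have : Nonempty V := ⟨z⟩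
      exact Nat.cast_pos.2 Fintype.card_pos
    have hq : (1 / 4 : ℝ) ≤ A.card * (1 / (Fintype.card V : ℝ)) := by
      rw [mul_one_div, le_div_iff₀ hcard]
      have : (Fintype.card V : ℝ) ≤ 4 * A.card := by exact_mod_cast hA
      linarith
    have e0 : 0 ≤ ε * (1 / (Fintype.card V : ℝ)) := by positivity
    have e1 : ε * t.res (f 0) ≤ γ * 2 ^ b := by nlinarith
    have e2 : 99 / 10000 ≤ (1 - ε) * ε := by nlinarith
    have e3 : 99 / 10000 * (1 / 4) ≤
        (1 - ε) * (A.card * (ε * (1 / (Fintype.card V : ℝ)))) := by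
      calc (99 / 10000 * (1 / 4) : ℝ) ≤ ((1 - ε) * ε) * (A.card * (1 / (Fintype.card V : ℝ))) :=
            mul_le_mul e2 hq (by norm_num) (by linarith)
        _ = _ := by ring
    linarith

end BaseGraph

/-- The hard instance, for given branching `b`, height `h` and hub degree `N`. -/
theorem exists_hard_instance {n b h N : ℕ} {ε α B : ℝ} (hb : 1 ≤ b) (hN : 1 ≤ N)
    (hM : 4 * treeSize b h + 8 ≤ 3 * n) (hε : 1 / 100 < ε) (hε1 : ε < 99 / 100) (hα : α < 1)
    (hB1 : 400 * 2 ^ b ≤ B * n) (hB2 : 2 * N + 1 ≤ B / 200 * n)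
    (hB : 400 ^ h * B ≤ 1 / 1000) :
    ∃ (G : MultiDigraph (Fin n)) (es : List (Fin n × Fin n)),
      (∀ u, 1 ≤ outDeg G u) ∧ es.length ≤ 2 ^ b * treeSize b h ∧
      numEdges (addEdges G es) ≤ N + n + 2 ^ b * treeSize b h ∧
      (∀ γ : ℝ, 0 < γ → γ * (numEdges (addEdges G es) : ℝ) ≤ α → MaintainsApprox ε γ α G es) ∧
      (∀ γ : ℝ, 0 < γ → MaintainsApprox ε γ α G es →
        ∀ (s : State (Fin n)) (T : ℕ), Execution ε γ G es s T → b ^ h * N ≤ T) := by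
  set M := treeSize b h with hMdef
  have hM1 : 1 ≤ M := treeSize_pos b h
  have hn : (0 : ℝ) < n := Nat.cast_pos.2 (by omega)
  -- Layout: tree on `0, …, M - 1`, then `A`, the sink `n - 2` and the hub `n - 1`. The values of
  -- `f` from `M` on play no role.
  let hub : Fin n := ⟨n - 1, by omega⟩
  let z : Fin n := ⟨n - 2, by omega⟩
  let f : ℕ → Fin n := fun i => if hi : i < n then ⟨i, hi⟩ else z
  let A : Finset (Fin n) := Finset.Ico ⟨M, by omega⟩ z
  have hval : ∀ i < M, (f i : ℕ) = i := fun i hi => by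
    simp only [f, dif_pos (show i < n by omega)]
  have hA : A.card = n - 2 - M := by simp [A, z]
  have hpos : ∀ u, 1 ≤ outDeg (baseGraph N A hub z (f 0)) u := fun u => by
    rw [outDeg_baseGraph]; split_ifs <;> omega
  have hlen : (treeSeq f hub b h 0).length ≤ 2 ^ b * M := length_treeSeq_le f hub b h 0
  have : Nonempty (Fin n) := ⟨z⟩
  refine ⟨baseGraph N A hub z (f 0), treeSeq f hub b h 0, hpos, hlen, ?_, ?_, ?_⟩
  · rw [numEdges_addEdges]
    have := numEdges_baseGraph_le N A hub z (f 0)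
    rw [Fintype.card_fin] at this
    omega
  · intro γ hγ hm
    exact maintainsApprox_of_mul_numEdges_le hpos (by linarith) (by linarith) hγ hm
  · intro γ hγ hma s T hex
    have hlt := hma.lt_inv_card hpos hγ hα
    have hlt' := hlt
    rw [Fintype.card_fin, lt_div_iff₀ hn] at hlt'
    have hγle : γ ≤ 1 / n := by rw [le_div_iff₀ hn]; exact hlt'.le
    refine le_time_of_execution (M := M) (B := B) ?_ hN le_rfl (by simp [A])
      (by rw [hA, Fintype.card_fin]; omega) hlt hB hex
    refine ⟨?_, ?_, ?_, ?_, ?_, ?_, hb, hε, hε1, hγ, ?_, ?_⟩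
    · intro i hi j hj hij
      rw [← hval i hi, ← hval j hj, hij]
    · intro i hi h'
      have := congrArg Fin.val h'
      rw [hval i hi] at this
      simp only [hub] at this
      omega
    · intro i hi h'
      have := congrArg Fin.val h'
      rw [hval i hi] at this
      simp only [z] at this
      omega
    · intro i hi h'
      have := Fin.le_def.1 (Finset.mem_Ico.1 (Finset.mem_coe.1 h')).1
      rw [hval i hi] at this
      exact absurd hi (not_lt.2 this)
    · intro h'
      have := congrArg Fin.val h'
      simp only [hub, z] at this
      omega
    · intro h'
      have := Fin.lt_def.1 (Finset.mem_Ico.1 (Finset.mem_coe.1 h')).2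
      simp only [hub, z] at this
      omega
    · calc 400 * (γ * 2 ^ b) = γ * (400 * 2 ^ b) := by ring
        _ ≤ 1 / n * (B * n) := mul_le_mul hγle hB1 (by positivity) (by positivity)
        _ = B := by field_simp
    · calc γ * (2 * N + 1) < 1 / n * (2 * N + 1) := by
            refine mul_lt_mul_of_pos_right ?_ (by positivity)
            rwa [Fintype.card_fin] at hlt
        _ ≤ 1 / n * (B / 200 * n) := mul_le_mul_of_nonneg_left hB2 (by positivity)
        _ = B / 200 := by field_simp

/-! ### Choice of parameters -/

section Parameters

/-- With `b = log₂ t`, the tree has at most `t ^ (q - 3)` vertices, and `N = t ^ (q - 2)`. As `b ≥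
400 ^ q`, the loss `400 ^ h` is at most `t`, so `B = 1 / (1000 t)` suffices. The exponent is `(q -
5) + (q - 2) = 2 q - 7`. -/
theorem exists_parameters_of_root {q t n : ℕ} (hq : 8 ≤ q) (ht : 2 ^ 400 ^ q ≤ t)
    (ht' : 10 ^ 6 ≤ t) (htn : t ^ q ≤ n) :
    ∃ b h N : ℕ, ∃ B : ℝ, 1 ≤ b ∧ 1 ≤ N ∧ 4 * treeSize b h + 8 ≤ 3 * n ∧ N ≤ n ∧
      2 ^ b * treeSize b h ≤ n ∧ (400 * 2 ^ b : ℝ) ≤ B * n ∧ (2 * N + 1 : ℝ) ≤ B / 200 * n ∧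
      400 ^ h * B ≤ 1 / 1000 ∧ t ^ (2 * q - 7) ≤ b ^ h * N := by
  obtain ⟨k, rfl⟩ := Nat.exists_eq_add_of_le hq
  have ht0 : t ≠ 0 := by omega
  set b := Nat.log 2 t with hb
  have hb2 : 2 ^ b ≤ t := Nat.pow_log_le_self 2 ht0
  have hbq : 400 ^ (8 + k) ≤ b := Nat.le_log_of_pow_le (by norm_num) ht
  have hb1 : 1 ≤ b := (Nat.one_le_pow _ _ (by norm_num)).trans hbq
  have hbt : b + 1 ≤ t := (Nat.succ_le_of_lt Nat.lt_two_pow_self).trans hb2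
  set h := Nat.log (b + 1) (t ^ (5 + k)) with hh
  have hle : (b + 1) ^ h ≤ t ^ (5 + k) := Nat.pow_log_le_self _ (pow_ne_zero _ ht0)
  have hlt : t ^ (5 + k) < (b + 1) ^ (h + 1) := Nat.lt_pow_succ_log_self (by omega) _
  have h400 : 400 ^ h ≤ t := by
    by_contra! hcon
    have h1 : t ^ (8 + k) < (400 ^ h) ^ (8 + k) := Nat.pow_lt_pow_left hcon (by omega)
    have h2 : (400 ^ h) ^ (8 + k) ≤ (b + 1) ^ h := by
      rw [← pow_mul, mul_comm, pow_mul]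
      exact Nat.pow_le_pow_left (by omega) _
    have h3 : t ^ (5 + k) ≤ t ^ (8 + k) := Nat.pow_le_pow_right (by omega) (by omega)
    omega
  have hM : treeSize b h ≤ t ^ (5 + k) := (treeSize_le b h).trans hle
  -- One factor `t` pays for rounding `h` down, another for replacing `b + 1` by `b`.
  have hbh : t ^ (3 + k) ≤ b ^ h := by
    have h1 : (b + 1) ^ h ≤ t * b ^ h := by
      calc (b + 1) ^ h ≤ (2 * b) ^ h := Nat.pow_le_pow_left (by omega) _
        _ = 2 ^ h * b ^ h := mul_pow _ _ _
        _ ≤ t * b ^ h := Nat.mul_le_mul_right _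
            ((Nat.pow_le_pow_left (by norm_num) h).trans h400)
    have h2 : t ^ 2 * t ^ (3 + k) ≤ t ^ 2 * b ^ h := by
      calc t ^ 2 * t ^ (3 + k) = t ^ (5 + k) := by rw [← pow_add]; congr 1; omega
        _ ≤ (b + 1) ^ h * (b + 1) := by rw [← pow_succ]; exact hlt.le
        _ ≤ (t * b ^ h) * t := Nat.mul_le_mul h1 hbt
        _ = t ^ 2 * b ^ h := by ring
    exact Nat.le_of_mul_le_mul_left h2 (by positivity)
  have hpow : ∀ i j, i ≤ j → t ^ i ≤ t ^ j := fun i j => Nat.pow_le_pow_right (by omega)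
  have htR : (10 ^ 6 : ℝ) ≤ t := by exact_mod_cast ht'
  have hnR : (t : ℝ) ^ (8 + k) ≤ n := by exact_mod_cast htn
  have hB1 : (t : ℝ) ^ (7 + k) / 1000 ≤ 1 / (1000 * t) * n := by
    have : (t : ℝ) ^ (7 + k) / 1000 = 1 / (1000 * t) * t ^ (8 + k) := by
      rw [show 8 + k = (7 + k) + 1 by omega, pow_succ]; field_simp
    rw [this]
    exact mul_le_mul_of_nonneg_left hnR (by positivity)
  refine ⟨b, h, t ^ (6 + k), 1 / (1000 * t), hb1, Nat.one_le_pow _ _ (by omega), ?_,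
    (hpow _ _ (by omega)).trans htn, ?_, ?_, ?_, ?_, ?_⟩
  · have h1 : t * t ^ (5 + k) ≤ n := by
      rw [← pow_succ']; exact (hpow _ _ (by omega)).trans htn
    have h2 : 1 ≤ t ^ (5 + k) := Nat.one_le_pow _ _ (by omega)
    nlinarith
  · calc 2 ^ b * treeSize b h ≤ t * t ^ (5 + k) := Nat.mul_le_mul hb2 hM
      _ = t ^ (6 + k) := by rw [← pow_succ']; congr 1; omega
      _ ≤ n := (hpow _ _ (by omega)).trans htn
  · have h1 : (2 : ℝ) ^ b ≤ t := by exact_mod_cast hb2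
    have h2 : (t : ℝ) ^ 2 ≤ t ^ (7 + k) := by exact_mod_cast hpow 2 (7 + k) (by omega)
    refine le_trans ?_ hB1
    nlinarith
  · have h1 : (1 : ℝ) ≤ t ^ (6 + k) := one_le_pow₀ (by linarith)
    have h2 : (t : ℝ) ^ (7 + k) = t ^ (6 + k) * t := by
      rw [← pow_succ]; congr 1; omega
    have h3 : (t : ℝ) ^ (6 + k) * 10 ^ 6 ≤ t ^ (7 + k) := by
      rw [h2]; exact mul_le_mul_of_nonneg_left htR (by linarith)
    push_cast
    linarith
  · have h1 : (400 : ℝ) ^ h ≤ t := by exact_mod_cast h400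
    rw [mul_one_div, div_le_div_iff₀ (by linarith) (by norm_num)]
    linarith
  · calc t ^ (2 * (8 + k) - 7) = t ^ (3 + k) * t ^ (6 + k) := by
          rw [← pow_add]; congr 1; omega
      _ ≤ _ := Nat.mul_le_mul_right _ hbh

/-- Here `t` is the integer part of `n ^ (1 / q)`. Rounding costs a factor below `2` in the base,
and `7 / q ≤ δ` handles the exponent. -/
theorem exists_root {δ : ℝ} {q n : ℕ} (hq : 8 ≤ q) (hqδ : 7 ≤ δ * q) (hn : 1 ≤ n) :
    ∃ t : ℕ, t ^ q ≤ n ∧ n < (t + 1) ^ q ∧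
      (1 / 2 ^ (2 * q - 7) : ℝ) * (n : ℝ) ^ (2 - δ) ≤ (t : ℝ) ^ (2 * q - 7) := by
  have hq0 : (0 : ℝ) < q := by
    have : (8 : ℝ) ≤ q := by exact_mod_cast hq
    linarith
  have hnR : (1 : ℝ) ≤ n := by exact_mod_cast hn
  set y : ℝ := (n : ℝ) ^ (1 / q : ℝ) with hy
  have hy1 : 1 ≤ y := Real.one_le_rpow hnR (by positivity)
  have hyq : y ^ q = n := by
    rw [hy, ← Real.rpow_natCast, ← Real.rpow_mul (by linarith), one_div_mul_cancel hq0.ne',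
      Real.rpow_one]
  have hty : (⌊y⌋₊ : ℝ) ≤ y := Nat.floor_le (by linarith)
  have hyt : y < ⌊y⌋₊ + 1 := Nat.lt_floor_add_one y
  have ht1 : (1 : ℝ) ≤ ⌊y⌋₊ := by exact_mod_cast Nat.one_le_floor_iff y |>.2 hy1
  refine ⟨⌊y⌋₊, ?_, ?_, ?_⟩
  · have : (⌊y⌋₊ : ℝ) ^ q ≤ n := hyq ▸ pow_le_pow_left₀ (by linarith) hty q
    exact_mod_cast this
  · have : (n : ℝ) < ((⌊y⌋₊ : ℝ) + 1) ^ q :=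
      hyq ▸ pow_lt_pow_left₀ hyt (by linarith) (by omega)
    exact_mod_cast this
  · have h1 : (n : ℝ) ^ (2 - δ) ≤ y ^ (2 * q - 7) := by
      rw [hy, ← Real.rpow_natCast, ← Real.rpow_mul (by linarith)]
      refine Real.rpow_le_rpow_of_exponent_le hnR ?_
      rw [Nat.cast_sub (by omega), one_div_mul_eq_div, le_div_iff₀ hq0]
      push_cast
      linarith
    have h2 : y ^ (2 * q - 7) ≤ (2 * ⌊y⌋₊ : ℝ) ^ (2 * q - 7) :=
      pow_le_pow_left₀ (by linarith) (by linarith) _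
    rw [mul_pow] at h2
    rw [one_div_mul_eq_div, div_le_iff₀ (by positivity)]
    linarith

end Parameters

end ForwardPush

/-! ### The main theorem -/

theorem mainTheorem5 :
    ∃ C : ℝ, 0 < C ∧ ∀ δ : ℝ, 0 < δ →
      ∃ c : ℝ, 0 < c ∧ ∃ n₀ : ℕ, ∀ n : ℕ, n₀ ≤ n →
        ∀ ε : ℝ, 0.01 < ε → ε < 0.99 → ∀ α : ℝ, 0 < α → α < 1 →
          ∃ (G : ForwardPush.MultiDigraph (Fin n)) (es : List (Fin n × Fin n)),
            (∀ u, 1 ≤ ForwardPush.outDeg G u) ∧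
            (es.length : ℝ) ≤ C * n ∧
            (ForwardPush.numEdges (ForwardPush.addEdges G es) : ℝ) ≤ C * n ∧
            (∀ γ : ℝ, 0 < γ →
              γ * (ForwardPush.numEdges (ForwardPush.addEdges G es) : ℝ) ≤ α →
              ForwardPush.MaintainsApprox ε γ α G es) ∧
            (∀ γ : ℝ, 0 < γ → ForwardPush.MaintainsApprox ε γ α G es →
              ∀ (s : ForwardPush.State (Fin n)) (T : ℕ),
                ForwardPush.Execution ε γ G es s T → c * (n : ℝ) ^ (2 - δ) ≤ (T : ℝ)) := by
  -- The hub's edges, the other initial edges and the insertions number at most `n` each.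
  refine ⟨3, by norm_num, fun δ hδ => ?_⟩
  obtain ⟨q, hq8, hqδ⟩ : ∃ q : ℕ, 8 ≤ q ∧ 7 ≤ δ * q := by
    refine ⟨max 8 ⌈7 / δ⌉₊, le_max_left _ _, ?_⟩
    have h1 : 7 / δ ≤ (max 8 ⌈7 / δ⌉₊ : ℕ) :=
      (Nat.le_ceil _).trans (Nat.cast_le.2 (le_max_right _ _))
    rwa [div_le_iff₀' hδ] at h1
  -- The threshold is a `q`-th power so that `n < (t + 1) ^ q` makes `t` large enough.
  refine ⟨1 / 2 ^ (2 * q - 7), by positivity, (2 ^ 400 ^ q + 10 ^ 6) ^ q,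
    fun n hn ε hε hε1 α _ hα => ?_⟩
  have hn1 : 1 ≤ n := (Nat.one_le_pow _ _ (by positivity)).trans hn
  obtain ⟨t, htn, hnt, hpow⟩ := ForwardPush.exists_root hq8 hqδ hn1
  have ht : 2 ^ 400 ^ q + 10 ^ 6 ≤ t :=
    Nat.lt_succ_iff.1 (lt_of_pow_lt_pow_left₀ q (Nat.zero_le _) (hn.trans_lt hnt))
  obtain ⟨b, h, N, B, hb, hN, hM, hNn, hlen, hB1, hB2, hB, hT⟩ :=
    ForwardPush.exists_parameters_of_root hq8 ((Nat.le_add_right _ _).trans ht)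
      ((Nat.le_add_left _ _).trans ht) htn
  obtain ⟨G, es, hG, hes, hm, hupper, hlower⟩ := ForwardPush.exists_hard_instance (ε := ε) hb hN hM
    (by norm_num at hε ⊢; linarith) (by norm_num at hε1 ⊢; linarith) hα hB1 hB2 hB
  refine ⟨G, es, hG, ?_, ?_, hupper, fun γ hγ hma s T hex => ?_⟩
  · exact_mod_cast (show es.length ≤ 3 * n by omega)
  · exact_mod_cast (show ForwardPush.numEdges (ForwardPush.addEdges G es) ≤ 3 * n by omega)
  · have h1 : t ^ (2 * q - 7) ≤ T := hT.trans (hlower γ hγ hma s T hex)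
    exact hpow.trans (by exact_mod_cast h1)
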